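/- For a graph $G$ with vertex set $V(G)$ and edge set $E(G)\neq\emptyset$, and a permutation $\pi$ of $V(G)$, let $\mathsf{AUT}(G;\pi)=|\{\{u,v\}\in E(G):\{\pi(u),\pi(v)\}\in E(G)\}|/|E(G)|$ be the fraction of edges preserved by $\pi$. For real $\beta,\gamma$, call $G$ $(\beta,\gamma)$-asymmetric if every permutation $\pi$ of $V(G)$ with at most $(1-\beta)|V(G)|$ fixed points satisfies $\mathsf{AUT}(G;\pi)<1-\gamma$. Let $\mathcal{G}_{n,m}$ denote a graph chosen uniformly at random from all simple graphs on $n$ labelled vertices with exactly $m$ edges. Theorem. There is an absolute constant $N$ such that the following holds for all integers $n\ge N$. Let $c$ be a real number with $10^4\le c\le n/10^{10}$ such that $m=cn$ is an integer, and let $\beta^*=\max\{e^{-c/6},\tfrac1n\}$. Then with probability at least $1-n^{-15}$, the random graph $\mathcal{G}_{n,m}$ is $(\beta,\beta/240)$-asymmetric simultaneously for all real $\beta$ with $\beta^*\le\beta\le 1$. -/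

import Mathlib

/-- For a bijection `π` between the vertex sets of two graphs `G` and `H`: the number of edges of
`G` that `π` maps to edges of `H`, divided by the larger of the two numbers of edges. -/
noncomputable def isoFraction {V W : Type*} (G : SimpleGraph V) (H : SimpleGraph W)
    (π : V ≃ W) : ℝ :=
  ({e : Sym2 V | e ∈ G.edgeSet ∧ Sym2.map π e ∈ H.edgeSet}.ncard : ℝ) /
    (max G.edgeSet.ncard H.edgeSet.ncard : ℕ)

/-- The fraction of the edges of `G` that the permutation `π` of its vertices maps to edges
of `G`. -/
noncomputable def autFraction {V : Type*} (G : SimpleGraph V) (π : Equiv.Perm V) : ℝ :=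
  isoFraction G G π

/-- `G` is `(β, γ)`-asymmetric: every permutation of the vertices that fixes at most a `1 - β`
fraction of them preserves less than a `1 - γ` fraction of the edges. -/
def IsRobustlyAsymmetric {V : Type*} (G : SimpleGraph V) (β γ : ℝ) : Prop :=
  ∀ π : Equiv.Perm V,
    ({v : V | π v = v}.ncard : ℝ) ≤ (1 - β) * (Nat.card V : ℝ) → autFraction G π < 1 - γ

/-- The random graph `G_{n,m}`: the uniform distribution on the simple graphs with vertex set
`Fin n` that have exactly `m` edges. -/
noncomputable def randomGraph (n m : ℕ) : MeasureTheory.Measure (SimpleGraph (Fin n)) :=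
  ProbabilityTheory.uniformOn {G : SimpleGraph (Fin n) | G.edgeSet.ncard = m}

/-!
Asymmetry fails only if, for some permutation `π` with a support `S` of size `k`, at most `c k / 240`
edges are broken, where `2 ≤ k` and `k ≥ n e^{-c/6}`; the largest admissible `β`, namely `k / n`, is
the one that matters. The proof is a union bound which treats `S` before `π`.

* *Few edges at `S`.* The expected number of edges meeting `S` is about `2 c k` for small `k` and never
  less than `c k`, so the probability of having at most `c k / 24` of them is exponentially small in
  `c k`. The Chernoff bound for sampling without replacement (`card_filter_inter_card_le`) comes from
  Maclaurin's inequality (`sum_powersetCard_prod_le`). There are only `n.choose k ≤ e^{k + c k / 6}`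
  sets `S`, and `choose_mul_exp_sub_le` weighs one against the other.

* *Many edges at `S`, few of them broken.* All but at most `k` of the pairs meeting `S` are moved by the
  action of `π` on pairs, so many edges `e` at `S` are moved to other edges of the graph. Since each
  such `e` shares an edge with at most two other pairs `(e, π e)`, a third of them give disjoint pairs
  (`exists_subset_disjoint_map`): there is a set `D` of `j = ⌈c k / 100⌉` edges for which `D` and `π D`
  are disjoint and both consist of edges. For a given `D` this has probability at most
  `(m / n.choose 2) ^ (2 j)`, about `(2 c / n) ^ (2 j)`, while there are at most `(k n).choose j`, about
  `(100 e n / c) ^ j`, choices of `D`. The product is at most `(1100 c / n) ^ j`, which is so small that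
  all `n ^ k` permutations with support `S`, and all `n ^ k` sets `S`, can be afforded
  (`pow_mul_choose_mul_div_pow_le`).

Each `k` contributes at most `2 n⁻¹⁷` in total, and there are at most `n + 1` values of `k`.
-/

/-! ### Random subsets of a given size -/

/-- Splitting the subsets of `insert i Y` according to whether they contain `i`. -/
theorem sum_powersetCard_succ_insert_prod {α : Type*} [DecidableEq α] (a : α → ℝ)
    {Y : Finset α} {i : α} (hi : i ∉ Y) (m : ℕ) :
    ∑ A ∈ (insert i Y).powersetCard (m + 1), ∏ x ∈ A, a x =
      ∑ A ∈ Y.powersetCard (m + 1), ∏ x ∈ A, a x +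
        a i * ∑ A ∈ Y.powersetCard m, ∏ x ∈ A, a x := by
  have hnot : ∀ {k : ℕ} {A : Finset α}, A ∈ Y.powersetCard k → i ∉ A := fun hA h =>
    hi ((Finset.mem_powersetCard.1 hA).1 h)
  rw [Finset.powersetCard_succ_insert hi, Finset.sum_union, Finset.sum_image, Finset.mul_sum]
  · congr 1
    refine Finset.sum_congr rfl fun A hA => ?_
    rw [Finset.prod_insert (hnot hA)]
  · intro A hA B hB hAB
    rw [← Finset.erase_insert (hnot hA), ← Finset.erase_insert (hnot hB), hAB]
  · rw [Finset.disjoint_left]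
    intro A hA hA'
    obtain ⟨B, -, rfl⟩ := Finset.mem_image.1 hA'
    exact hnot hA (Finset.mem_insert_self _ _)

theorem sum_powersetCard_erase_prod_le {α : Type*} [DecidableEq α] {a : α → ℝ}
    (ha : ∀ i, 0 ≤ a i) {X : Finset α} {i j : α} (hi : i ∈ X) (hj : j ∈ X) (hij : a i ≤ a j)
    (m : ℕ) :
    ∑ A ∈ (X.erase j).powersetCard m, ∏ x ∈ A, a x ≤
      ∑ A ∈ (X.erase i).powersetCard m, ∏ x ∈ A, a x := by
  rcases eq_or_ne i j with rfl | hne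
  · exact le_rfl
  cases m with
  | zero => simp
  | succ m =>
    have h1 : X.erase j = insert i ((X.erase i).erase j) := by
      rw [Finset.erase_right_comm, Finset.insert_erase (by simp [hne, hi])]
    have h2 : X.erase i = insert j ((X.erase i).erase j) := by
      rw [Finset.insert_erase (by simp [hne.symm, hj])]
    rw [h1, sum_powersetCard_succ_insert_prod _ (by simp), h2,
      sum_powersetCard_succ_insert_prod _ (by simp), ← h2]
    gcongr
    exact Finset.sum_nonneg fun A _ => Finset.prod_nonneg fun x _ => ha x

theorem sum_mul_sum_powersetCard_erase_prod {α : Type*} [DecidableEq α] (a : α → ℝ)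
    (X : Finset α) (m : ℕ) :
    ∑ i ∈ X, a i * ∑ A ∈ (X.erase i).powersetCard m, ∏ x ∈ A, a x =
      (m + 1) * ∑ A ∈ X.powersetCard (m + 1), ∏ x ∈ A, a x := by
  have h : ∀ A ∈ X.powersetCard (m + 1), ((m : ℝ) + 1) * ∏ x ∈ A, a x =
      ∑ i ∈ A, ∏ x ∈ A, a x := by
    intro A hA
    simp [(Finset.mem_powersetCard.1 hA).2]
  simp_rw [Finset.mul_sum]
  rw [Finset.sum_congr rfl h, Finset.sum_sigma', Finset.sum_sigma']
  refine Finset.sum_bij' (fun p _ => ⟨insert p.1 p.2, p.1⟩) (fun p _ => ⟨p.2, p.1.erase p.2⟩)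
    ?_ ?_ ?_ ?_ ?_
  · rintro ⟨i, A⟩ hA
    simp only [Finset.mem_sigma, Finset.mem_powersetCard, Finset.subset_erase] at hA ⊢
    obtain ⟨hi, ⟨hAX, hiA⟩, hc⟩ := hA
    exact ⟨⟨Finset.insert_subset hi hAX, by rw [Finset.card_insert_of_notMem hiA, hc]⟩,
      Finset.mem_insert_self _ _⟩
  · rintro ⟨A, i⟩ hA
    simp only [Finset.mem_sigma, Finset.mem_powersetCard] at hA ⊢
    obtain ⟨⟨hAX, hc⟩, hi⟩ := hA
    exact ⟨hAX hi, Finset.erase_subset_erase _ hAX, by rw [Finset.card_erase_of_mem hi, hc]; rfl⟩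
  · rintro ⟨i, A⟩ hA
    simp only [Finset.mem_sigma, Finset.mem_powersetCard, Finset.subset_erase] at hA
    simp [Finset.erase_insert hA.2.1.2]
  · rintro ⟨A, i⟩ hA
    simp only [Finset.mem_sigma, Finset.mem_powersetCard] at hA
    simp [Finset.insert_erase hA.2]
  · rintro ⟨i, A⟩ hA
    simp only [Finset.mem_sigma, Finset.mem_powersetCard, Finset.subset_erase] at hA
    simp [Finset.prod_insert hA.2.1.2]

theorem sum_sum_powersetCard_erase {α : Type*} [DecidableEq α] (f : Finset α → ℝ)
    (X : Finset α) (m : ℕ) :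
    ∑ i ∈ X, ∑ A ∈ (X.erase i).powersetCard m, f A =
      ((X.card : ℝ) - m) * ∑ A ∈ X.powersetCard m, f A := by
  rw [Finset.sum_comm' (t' := X.powersetCard m) (s' := fun A => X \ A), Finset.mul_sum]
  · refine Finset.sum_congr rfl fun A hA => ?_
    rw [Finset.mem_powersetCard] at hA
    rw [Finset.sum_const, nsmul_eq_mul, Finset.card_sdiff_of_subset hA.1, Nat.cast_sub
      (Finset.card_le_card hA.1), hA.2]
  · intro i A
    simp only [Finset.mem_powersetCard, Finset.subset_erase, Finset.mem_sdiff]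
    tauto

/-- **Maclaurin's inequality** between an elementary symmetric mean and the arithmetic mean. In
probabilistic terms, the expected product of the weights in a random `m`-subset is at most what it
would be for `m` independent draws. It follows by induction on `m` from Chebyshev's sum inequality:
the larger `a i`, the smaller the symmetric sum over the other elements. -/
theorem sum_powersetCard_prod_le {α : Type*} [DecidableEq α] {a : α → ℝ}
    (ha : ∀ i, 0 ≤ a i) (X : Finset α) (m : ℕ) :
    ∑ A ∈ X.powersetCard m, ∏ x ∈ A, a x ≤
      (X.card.choose m : ℝ) * ((∑ i ∈ X, a i) / X.card) ^ m := by
  induction m with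
  | zero => simp
  | succ m ih =>
    have hS : 0 ≤ ∑ i ∈ X, a i := Finset.sum_nonneg fun i _ => ha i
    rcases Nat.lt_or_ge X.card (m + 1) with hlt | hge
    · rw [Finset.powersetCard_eq_empty.2 hlt, Finset.sum_empty]
      positivity
    have hX : (0 : ℝ) < X.card := by exact_mod_cast (Nat.succ_pos m).trans_le hge
    have hcheb := AntivaryOn.card_mul_sum_le_sum_mul_sum (s := X) (f := a)
      (g := fun i => ∑ A ∈ (X.erase i).powersetCard m, ∏ x ∈ A, a x) (by
        intro i hi j hj hlt
        by_contra! hcon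
        exact absurd (sum_powersetCard_erase_prod_le ha hi hj hcon.le m) (not_le.2 hlt))
    rw [sum_mul_sum_powersetCard_erase_prod, sum_sum_powersetCard_erase] at hcheb
    have hch : (X.card.choose (m + 1) : ℝ) * (m + 1) = X.card.choose m * ((X.card : ℝ) - m) := by
      have := Nat.choose_succ_right_eq X.card m
      rw [← Nat.cast_sub (by omega)]
      exact_mod_cast this
    have hm : (0 : ℝ) ≤ (X.card : ℝ) - m := by
      rw [sub_nonneg]
      exact_mod_cast (Nat.le_succ m).trans hge
    refine le_of_mul_le_mul_left ?_ (show (0 : ℝ) < X.card * (m + 1) by positivity)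
    calc (X.card : ℝ) * (m + 1) * ∑ A ∈ X.powersetCard (m + 1), ∏ x ∈ A, a x
        ≤ (∑ i ∈ X, a i) * (((X.card : ℝ) - m) * ∑ A ∈ X.powersetCard m, ∏ x ∈ A, a x) := by
          rw [mul_assoc]; exact hcheb
      _ ≤ (∑ i ∈ X, a i) * (((X.card : ℝ) - m) *
            ((X.card.choose m : ℝ) * ((∑ i ∈ X, a i) / X.card) ^ m)) := by gcongr
      _ = (∑ i ∈ X, a i) * ((X.card.choose (m + 1) : ℝ) * (m + 1) *
            ((∑ i ∈ X, a i) / X.card) ^ m) := by rw [hch]; ring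
      _ = _ := by rw [pow_succ]; field_simp

/-- Chernoff bound for the lower tail of the hypergeometric distribution, with the exponential
parameter fixed at `4`. -/
theorem card_filter_inter_card_le {α : Type*} [DecidableEq α] {X T : Finset α} (hT : T ⊆ X)
    (m : ℕ) (d : ℝ) :
    (((X.powersetCard m).filter fun A => ((A ∩ T).card : ℝ) ≤ d).card : ℝ) ≤
      (X.card.choose m : ℝ) *
        Real.exp (4 * d - (1 - Real.exp (-4)) * (T.card * m / X.card)) := by
  set a : α → ℝ := fun i => if i ∈ T then Real.exp (-4) else 1 with ha_def
  have ha : ∀ i, 0 ≤ a i := fun i => by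
    simp only [ha_def]; split_ifs <;> positivity
  have hprod : ∀ A : Finset α, ∏ x ∈ A, a x = Real.exp (-(4 * (A ∩ T).card)) := by
    intro A
    simp only [ha_def]
    rw [Finset.prod_ite, Finset.prod_const_one, mul_one, Finset.prod_const,
      Finset.filter_mem_eq_inter, ← Real.exp_nat_mul]
    ring_nf
  have hsum : ∑ i ∈ X, a i = X.card - (1 - Real.exp (-4)) * T.card := by
    have h : ∀ i ∈ X, a i = 1 - if i ∈ T then (1 - Real.exp (-4)) else 0 := fun i _ => by
      simp only [ha_def]; split_ifs <;> ring
    rw [Finset.sum_congr rfl h, Finset.sum_sub_distrib, ← Finset.sum_filter,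
      Finset.filter_mem_eq_inter, Finset.inter_eq_right.2 hT]
    simp
    ring
  have hkey := sum_powersetCard_prod_le ha X m
  have hlow : (((X.powersetCard m).filter fun A => ((A ∩ T).card : ℝ) ≤ d).card : ℝ) *
      Real.exp (-(4 * d)) ≤ ∑ A ∈ X.powersetCard m, ∏ x ∈ A, a x := by
    calc _ = ∑ A ∈ (X.powersetCard m).filter (fun A => ((A ∩ T).card : ℝ) ≤ d),
          Real.exp (-(4 * d)) := by simp
      _ ≤ ∑ A ∈ (X.powersetCard m).filter (fun A => ((A ∩ T).card : ℝ) ≤ d),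
          ∏ x ∈ A, a x := by
        refine Finset.sum_le_sum fun A hA => ?_
        rw [hprod]
        have := (Finset.mem_filter.1 hA).2
        gcongr
      _ ≤ _ := Finset.sum_le_sum_of_subset_of_nonneg (Finset.filter_subset _ _)
          fun A _ _ => Finset.prod_nonneg fun x _ => ha x
  have hmean : ((∑ i ∈ X, a i) / X.card) ^ m ≤
      Real.exp (-((1 - Real.exp (-4)) * (T.card * m / X.card))) := by
    have h0 : 0 ≤ (∑ i ∈ X, a i) / X.card :=
      div_nonneg (Finset.sum_nonneg fun i _ => ha i) (Nat.cast_nonneg _)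
    have h1 : (∑ i ∈ X, a i) / X.card ≤
        Real.exp (-((1 - Real.exp (-4)) * (T.card / X.card))) := by
      refine le_trans ?_ (Real.add_one_le_exp _)
      rw [hsum, sub_div, neg_add_eq_sub, mul_div_assoc]
      gcongr
      exact div_self_le_one _
    calc _ ≤ (Real.exp (-((1 - Real.exp (-4)) * (T.card / X.card)))) ^ m := by gcongr
      _ = _ := by rw [← Real.exp_nat_mul]; ring_nf
  have hfin := hlow.trans (hkey.trans (mul_le_mul_of_nonneg_left hmean (Nat.cast_nonneg _)))
  rw [Real.exp_neg, ← div_eq_mul_inv, div_le_iff₀ (Real.exp_pos _)] at hfin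
  refine hfin.trans (le_of_eq ?_)
  rw [mul_assoc, ← Real.exp_add]
  ring_nf

theorem choose_sub_sub_le {M m r : ℕ} (hr : r ≤ m) (hm : m ≤ M) :
    ((M - r).choose (m - r) : ℝ) ≤ M.choose m * ((m : ℝ) / M) ^ r := by
  induction r generalizing M m with
  | zero => simp
  | succ r ih =>
    obtain ⟨m, rfl⟩ : ∃ m', m = m' + 1 := ⟨m - 1, by omega⟩
    obtain ⟨M, rfl⟩ : ∃ M', M = M' + 1 := ⟨M - 1, by omega⟩
    have hle : (m : ℝ) / M ≤ ((m + 1 : ℕ) : ℝ) / (M + 1 : ℕ) := by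
      have hmM : (m : ℝ) ≤ M := by exact_mod_cast Nat.le_of_succ_le_succ hm
      rcases Nat.eq_zero_or_pos M with rfl | hM
      · simp; positivity
      · push_cast
        rw [div_le_div_iff₀ (by positivity) (by positivity)]
        nlinarith
    have hch : ((M.choose m : ℕ) : ℝ) =
        (M + 1).choose (m + 1) * (((m + 1 : ℕ) : ℝ) / (M + 1 : ℕ)) := by
      have := Nat.add_one_mul_choose_eq M m
      rw [mul_div_assoc', eq_div_iff (by positivity), mul_comm]
      exact_mod_cast this
    rw [Nat.add_sub_add_right, Nat.add_sub_add_right]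
    calc ((M - r).choose (m - r) : ℝ) ≤ M.choose m * ((m : ℝ) / M) ^ r := ih (by omega) (by omega)
      _ ≤ M.choose m * (((m + 1 : ℕ) : ℝ) / (M + 1 : ℕ)) ^ r := by gcongr
      _ = _ := by rw [hch]; ring

/-- A random `m`-subset of `X` contains a given set with at most the probability that would hold if
each element were present independently with probability `m / |X|`. -/
theorem card_filter_subset_le {α : Type*} [DecidableEq α] {X R : Finset α} (hR : R ⊆ X)
    (m : ℕ) :
    (((X.powersetCard m).filter fun A => R ⊆ A).card : ℝ) ≤
      X.card.choose m * ((m : ℝ) / X.card) ^ R.card := by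
  rcases Nat.lt_or_ge X.card m with hlt | hm
  · rw [Finset.powersetCard_eq_empty.2 hlt]
    simp; positivity
  rcases Nat.lt_or_ge m R.card with hlt | hr
  · rw [Finset.filter_false_of_mem]
    · simp; positivity
    · intro A hA hRA
      have := Finset.card_le_card hRA
      rw [(Finset.mem_powersetCard.1 hA).2] at this
      omega
  refine le_trans ?_ (choose_sub_sub_le hr hm)
  rw [← Finset.card_sdiff_of_subset hR, ← Finset.card_powersetCard]
  norm_cast
  refine Finset.card_le_card_of_injOn (fun A => A \ R) ?_ ?_
  · intro A hA
    simp only [Finset.coe_filter, Finset.mem_powersetCard, Set.mem_ofPred_eq, Finset.mem_coe]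
      at hA ⊢
    exact ⟨Finset.sdiff_subset_sdiff hA.1.1 le_rfl,
      by rw [Finset.card_sdiff_of_subset hA.2, hA.1.2]⟩
  · intro A hA B hB hAB
    simp only [Finset.coe_filter, Set.mem_ofPred_eq] at hA hB
    have h : A \ R = B \ R := hAB
    rw [← Finset.sdiff_union_of_subset hA.2, h, Finset.sdiff_union_of_subset hB.2]

/-! ### Sets that a permutation nearly preserves -/

/-- Given elements moved by `σ`, a third of them can be selected so that `σ` moves the selection off
itself: a maximal such selection `D` satisfies `P ⊆ D ∪ σ D ∪ σ⁻¹ D`. -/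
theorem exists_subset_disjoint_map {α : Type*} [DecidableEq α] (σ : Equiv.Perm α)
    (P : Finset α) (hP : ∀ e ∈ P, σ e ≠ e) :
    ∃ D ⊆ P, Disjoint D (D.map σ.toEmbedding) ∧ P.card ≤ 3 * D.card := by
  obtain ⟨D, hD, hmax⟩ := (P.powerset.filter fun D =>
    Disjoint D (D.map σ.toEmbedding)).exists_max_image Finset.card ⟨∅, by simp⟩
  simp only [Finset.mem_filter, Finset.mem_powerset] at hD hmax
  refine ⟨D, hD.1, hD.2, ?_⟩
  have hcover : P ⊆ D ∪ D.map σ.toEmbedding ∪ D.map σ.symm.toEmbedding := by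
    intro e he
    by_contra hcon
    simp only [Finset.mem_union, Finset.mem_map_equiv, not_or, Equiv.symm_symm] at hcon
    obtain ⟨⟨h1, h2⟩, h3⟩ := hcon
    have := hmax (insert e D) ⟨Finset.insert_subset he hD.1, ?_⟩
    · rw [Finset.card_insert_of_notMem h1] at this
      omega
    · have hdis := hD.2
      rw [Finset.disjoint_left] at hdis ⊢
      intro x hx hx'
      simp only [Finset.mem_insert, Finset.mem_map_equiv] at hx hx' hdis
      rcases hx with rfl | hx <;> rcases hx' with hx' | hx'
      · exact hP x he (by conv_lhs => rw [← hx']; simp)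
      · exact h2 hx'
      · rw [Equiv.symm_apply_eq] at hx'
        exact h3 (hx' ▸ hx)
      · exact hdis hx hx'
  have h1 := Finset.card_le_card hcover
  have h2 := Finset.card_union_le (D ∪ D.map σ.toEmbedding) (D.map σ.symm.toEmbedding)
  have h3 := Finset.card_union_le D (D.map σ.toEmbedding)
  simp only [Finset.card_map] at h2 h3
  omega

/-- Few `m`-subsets of `X` contain `j` elements of `U` along with `j` distinct images of these
under `σ`. -/
theorem card_filter_exists_map_subset_le {α : Type*} [DecidableEq α] (σ : Equiv.Perm α)
    {X U : Finset α} (m j : ℕ) :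
    (((X.powersetCard m).filter fun A => ∃ D ⊆ U, D.card = j ∧
        Disjoint D (D.map σ.toEmbedding) ∧ D ∪ D.map σ.toEmbedding ⊆ A).card : ℝ) ≤
      U.card.choose j * (X.card.choose m * ((m : ℝ) / X.card) ^ (2 * j)) := by
  set F := (U.powersetCard j).filter fun D =>
    Disjoint D (D.map σ.toEmbedding) ∧ D ∪ D.map σ.toEmbedding ⊆ X with hF
  have hsub : ((X.powersetCard m).filter fun A => ∃ D ⊆ U, D.card = j ∧
        Disjoint D (D.map σ.toEmbedding) ∧ D ∪ D.map σ.toEmbedding ⊆ A) ⊆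
      F.biUnion fun D => (X.powersetCard m).filter fun A => D ∪ D.map σ.toEmbedding ⊆ A := by
    intro A hA
    simp only [Finset.mem_filter, Finset.mem_powersetCard, Finset.mem_biUnion, hF] at hA ⊢
    obtain ⟨⟨hAX, hc⟩, D, hDU, hDj, hdis, hDA⟩ := hA
    exact ⟨D, ⟨⟨hDU, hDj⟩, hdis, hDA.trans hAX⟩, ⟨hAX, hc⟩, hDA⟩
  have h1 := (Finset.card_le_card hsub).trans Finset.card_biUnion_le
  calc _ ≤ ((∑ D ∈ F, ((X.powersetCard m).filter fun A =>
        D ∪ D.map σ.toEmbedding ⊆ A).card : ℕ) : ℝ) := by exact_mod_cast h1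
    _ ≤ ∑ D ∈ F, (X.card.choose m * ((m : ℝ) / X.card) ^ (2 * j)) := by
      push_cast
      refine Finset.sum_le_sum fun D hD => ?_
      simp only [Finset.mem_filter, Finset.mem_powersetCard, hF] at hD
      refine (card_filter_subset_le hD.2.2 m).trans (le_of_eq ?_)
      rw [Finset.card_union_of_disjoint hD.2.1, Finset.card_map, hD.1.2, two_mul]
    _ = F.card * (X.card.choose m * ((m : ℝ) / X.card) ^ (2 * j)) := by simp
    _ ≤ _ := by
      gcongr
      rw [← Finset.card_powersetCard]
      exact Finset.card_le_card (Finset.filter_subset _ _)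

/-! ### The action of a vertex permutation on pairs -/

/-- The pairs of distinct vertices of which at least one lies in `S`. -/
def pairsMeeting {V : Type*} [Fintype V] [DecidableEq V] (S : Finset V) : Finset (Sym2 V) :=
  (⊤ : SimpleGraph V).edgeFinset.filter fun e => ∃ v ∈ S, v ∈ e

/-- The permutation of the unordered pairs that a permutation of the vertices induces. -/
def pairPerm {V : Type*} (π : Equiv.Perm V) : Equiv.Perm (Sym2 V) where
  toFun := Sym2.map π
  invFun := Sym2.map π.symm
  left_inv e := by simp [Sym2.map_map]
  right_inv e := by simp [Sym2.map_map]

@[simp] theorem pairPerm_apply {V : Type*} (π : Equiv.Perm V) (e : Sym2 V) :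
    pairPerm π e = Sym2.map π e := rfl

theorem pairsMeeting_subset {V : Type*} [Fintype V] [DecidableEq V] (S : Finset V) :
    pairsMeeting S ⊆ (⊤ : SimpleGraph V).edgeFinset := Finset.filter_subset _ _

theorem card_pairsMeeting_le {V : Type*} [Fintype V] [DecidableEq V] (S : Finset V) :
    (pairsMeeting S).card ≤ S.card * Fintype.card V := by
  have h : pairsMeeting S ⊆ (S ×ˢ Finset.univ).image fun p : V × V => s(p.1, p.2) := by
    intro e he
    obtain ⟨v, hv, hve⟩ := (Finset.mem_filter.1 he).2
    obtain ⟨w, rfl⟩ := Sym2.mem_iff_exists.1 hve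
    exact Finset.mem_image.2 ⟨(v, w), by simp [hv], rfl⟩
  calc _ ≤ _ := Finset.card_le_card h
    _ ≤ _ := Finset.card_image_le
    _ = _ := by rw [Finset.card_product, Finset.card_univ]

theorem choose_two_le_card_pairsMeeting_add {V : Type*} [Fintype V] [DecidableEq V]
    (S : Finset V) :
    (Fintype.card V).choose 2 ≤
      (pairsMeeting S).card + (Fintype.card V - S.card).choose 2 := by
  rw [← SimpleGraph.card_edgeFinset_top_eq_card_choose_two, ← Finset.card_compl,
    ← Sym2.card_image_offDiag]
  refine (Finset.card_le_card ?_).trans (Finset.card_union_le _ _)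
  intro e he
  by_cases hS : ∃ v ∈ S, v ∈ e
  · exact Finset.mem_union_left _ (Finset.mem_filter.2 ⟨he, hS⟩)
  · refine Finset.mem_union_right _ ?_
    induction e with | _ u v => ?_
    push Not at hS
    have huv : u ≠ v := by simpa using he
    refine Finset.mem_image.2 ⟨(u, v), ?_, rfl⟩
    simp only [Finset.mem_offDiag, Finset.mem_compl]
    exact ⟨fun h => hS u h (by simp), fun h => hS v h (by simp), huv⟩

theorem card_pairsMeeting_support_fixed_le {V : Type*} [Fintype V] [DecidableEq V]
    (π : Equiv.Perm V) :
    ((pairsMeeting π.support).filter fun e => pairPerm π e = e).card ≤ π.support.card := by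
  have h : ((pairsMeeting π.support).filter fun e => pairPerm π e = e) ⊆
      π.support.image fun v => s(v, π v) := by
    intro e he
    obtain ⟨he, hfix⟩ := Finset.mem_filter.1 he
    obtain ⟨v, hv, hve⟩ := (Finset.mem_filter.1 he).2
    obtain ⟨w, rfl⟩ := Sym2.mem_iff_exists.1 hve
    refine Finset.mem_image.2 ⟨v, hv, ?_⟩
    rw [pairPerm_apply, Sym2.map_mk, Sym2.eq_iff] at hfix
    rcases hfix with h | h
    · exact absurd h.1 (Equiv.Perm.mem_support.1 hv)
    · rw [h.1]
  exact (Finset.card_le_card h).trans Finset.card_image_le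

/-- An edge at a moved vertex is either broken by `π`, or one of the few pairs that `π` maps to
themselves, or a moved edge whose image is another edge. -/
theorem card_inter_pairsMeeting_add_le {V : Type*} [Fintype V] [DecidableEq V]
    (π : Equiv.Perm V) (A : Finset (Sym2 V)) :
    (A ∩ pairsMeeting π.support).card + (A.filter fun e => pairPerm π e ∈ A).card ≤
      A.card + π.support.card + ((A ∩ pairsMeeting π.support).filter fun e =>
        pairPerm π e ≠ e ∧ pairPerm π e ∈ A).card := by
  have hsub : A ∩ pairsMeeting π.support ⊆ (A.filter fun e => pairPerm π e ∉ A) ∪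
      ((pairsMeeting π.support).filter fun e => pairPerm π e = e) ∪
      ((A ∩ pairsMeeting π.support).filter fun e => pairPerm π e ≠ e ∧ pairPerm π e ∈ A) := by
    intro e he
    simp only [Finset.mem_union, Finset.mem_filter, Finset.mem_inter] at he ⊢
    tauto
  have h1 := Finset.card_le_card hsub
  have h2 := Finset.card_union_le ((A.filter fun e => pairPerm π e ∉ A) ∪
      ((pairsMeeting π.support).filter fun e => pairPerm π e = e))
      ((A ∩ pairsMeeting π.support).filter fun e => pairPerm π e ≠ e ∧ pairPerm π e ∈ A)
  have h3 := Finset.card_union_le (A.filter fun e => pairPerm π e ∉ A)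
      ((pairsMeeting π.support).filter fun e => pairPerm π e = e)
  have h4 := card_pairsMeeting_support_fixed_le π
  have h5 := Finset.card_filter_add_card_filter_not (s := A) (fun e => pairPerm π e ∈ A)
  omega

theorem exists_subset_pairsMeeting_disjoint_map {V : Type*} [Fintype V] [DecidableEq V]
    (π : Equiv.Perm V) (A : Finset (Sym2 V)) (j : ℕ)
    (h : A.card + π.support.card + 3 * j ≤ (A ∩ pairsMeeting π.support).card +
      (A.filter fun e => pairPerm π e ∈ A).card) :
    ∃ D ⊆ pairsMeeting π.support, D.card = j ∧ Disjoint D (D.map (pairPerm π).toEmbedding) ∧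
      D ∪ D.map (pairPerm π).toEmbedding ⊆ A := by
  have hP := card_inter_pairsMeeting_add_le π A
  obtain ⟨D, hDP, hdis, hcard⟩ := exists_subset_disjoint_map (pairPerm π)
    ((A ∩ pairsMeeting π.support).filter fun e => pairPerm π e ≠ e ∧ pairPerm π e ∈ A)
    fun e he => (Finset.mem_filter.1 he).2.1
  obtain ⟨D', hD', hj⟩ := Finset.exists_subset_card_eq (show j ≤ D.card by omega)
  have hmem : ∀ e ∈ D', e ∈ A ∧ e ∈ pairsMeeting π.support ∧ pairPerm π e ∈ A := fun e he => by
    have := hDP (hD' he)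
    simp only [Finset.mem_filter, Finset.mem_inter] at this
    tauto
  refine ⟨D', fun e he => (hmem e he).2.1, hj,
    hdis.mono hD' (Finset.map_subset_map.2 hD'), ?_⟩
  refine Finset.union_subset (fun e he => (hmem e he).1) fun e he => ?_
  obtain ⟨e', he', rfl⟩ := Finset.mem_map.1 he
  exact (hmem e' he').2.2

theorem card_filter_support_eq_le {V : Type*} [Fintype V] [DecidableEq V] (S : Finset V) :
    ((Finset.univ : Finset (Equiv.Perm V)).filter fun π => π.support = S).card ≤
      Fintype.card V ^ S.card := by
  rw [← Fintype.card_coe S, ← Fintype.card_fun, ← Finset.card_univ]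
  refine Finset.card_le_card_of_injOn (fun π => fun v : S => π v) (by simp) ?_
  intro π hπ ρ hρ h
  simp only [Finset.coe_filter, Finset.mem_univ, true_and, Set.mem_ofPred_eq] at hπ hρ
  ext v
  by_cases hv : v ∈ S
  · exact congrFun h ⟨v, hv⟩
  · have h1 : π v = v := by rwa [← Equiv.Perm.notMem_support, hπ]
    have h2 : ρ v = v := by rwa [← Equiv.Perm.notMem_support, hρ]
    rw [h1, h2]

/-! ### The edge sets to be avoided -/

/-- The `m`-element edge sets that have at most `d` edges at `S`, or for which some permutation
with support `S` maps `j` of the edges at `S` to `j` further edges. -/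
noncomputable def badEdgeSets {V : Type*} [Fintype V] [DecidableEq V] (m j : ℕ) (d : ℝ)
    (S : Finset V) : Finset (Finset (Sym2 V)) :=
  ((⊤ : SimpleGraph V).edgeFinset.powersetCard m).filter
      (fun A => ((A ∩ pairsMeeting S).card : ℝ) ≤ d) ∪
    ((Finset.univ : Finset (Equiv.Perm V)).filter fun π => π.support = S).biUnion fun π =>
      ((⊤ : SimpleGraph V).edgeFinset.powersetCard m).filter fun A =>
        ∃ D ⊆ pairsMeeting S, D.card = j ∧ Disjoint D (D.map (pairPerm π).toEmbedding) ∧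
          D ∪ D.map (pairPerm π).toEmbedding ⊆ A

theorem card_badEdgeSets_le {V : Type*} [Fintype V] [DecidableEq V] (m j : ℕ) (d : ℝ)
    (S : Finset V) :
    ((badEdgeSets m j d S).card : ℝ) ≤ ((Fintype.card V).choose 2).choose m *
      (Real.exp (4 * d - (1 - Real.exp (-4)) *
          ((pairsMeeting S).card * m / (Fintype.card V).choose 2)) +
        (Fintype.card V : ℝ) ^ S.card * (((S.card * Fintype.card V).choose j : ℕ) *
          ((m : ℝ) / (Fintype.card V).choose 2) ^ (2 * j))) := by
  have hX := SimpleGraph.card_edgeFinset_top_eq_card_choose_two (V := V)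
  have h1 := card_filter_inter_card_le (pairsMeeting_subset S) m d
  have h2 : (((((Finset.univ : Finset (Equiv.Perm V)).filter fun π => π.support = S).biUnion
      fun π => ((⊤ : SimpleGraph V).edgeFinset.powersetCard m).filter fun A =>
        ∃ D ⊆ pairsMeeting S, D.card = j ∧ Disjoint D (D.map (pairPerm π).toEmbedding) ∧
          D ∪ D.map (pairPerm π).toEmbedding ⊆ A).card : ℕ) : ℝ) ≤
      (Fintype.card V : ℝ) ^ S.card * (((S.card * Fintype.card V).choose j : ℕ) *
        (((Fintype.card V).choose 2).choose m *
          ((m : ℝ) / (Fintype.card V).choose 2) ^ (2 * j))) := by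
    refine le_trans (Nat.cast_le.2 Finset.card_biUnion_le) ?_
    push_cast
    refine (Finset.sum_le_card_nsmul _ _ _ fun π _ =>
      card_filter_exists_map_subset_le (pairPerm π) m j).trans ?_
    rw [nsmul_eq_mul, hX]
    gcongr
    · exact_mod_cast card_filter_support_eq_le S
    · exact card_pairsMeeting_le S
  rw [hX] at h1
  refine le_trans (Nat.cast_le.2 (Finset.card_union_le _ _)) ?_
  push_cast
  refine (add_le_add h1 h2).trans (le_of_eq ?_)
  ring

/-! ### Graphs with a given number of edges -/

instance SimpleGraph.instMeasurableSingletonClassOfCountable {V : Type*} [Countable V] :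
    MeasurableSingletonClass (SimpleGraph V) := by
  refine ⟨fun G => ⟨{G.Adj}, measurableSet_singleton _, ?_⟩⟩
  ext H
  exact ⟨fun h => SimpleGraph.ext h, fun h => congrArg SimpleGraph.Adj h⟩

open Classical in
theorem card_filter_ncard_edgeSet_eq {V : Type*} [Fintype V] (m : ℕ) :
    ((Finset.univ : Finset (SimpleGraph V)).filter fun G => G.edgeSet.ncard = m).card =
      ((Fintype.card V).choose 2).choose m := by
  rw [← SimpleGraph.card_edgeFinset_top_eq_card_choose_two, ← Finset.card_powersetCard]
  refine Finset.card_bij (fun G _ => G.edgeFinset) ?_ ?_ ?_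
  · intro G hG
    rw [Finset.mem_filter, ← SimpleGraph.coe_edgeFinset, Set.ncard_coe_finset] at hG
    exact Finset.mem_powersetCard.2 ⟨SimpleGraph.edgeFinset_mono le_top, hG.2⟩
  · intro G _ H _ h
    exact SimpleGraph.edgeFinset_inj.1 h
  · intro A hA
    obtain ⟨hAX, hc⟩ := Finset.mem_powersetCard.1 hA
    have hset : (SimpleGraph.fromEdgeSet (A : Set (Sym2 V))).edgeSet = A := by
      rw [SimpleGraph.edgeSet_fromEdgeSet, sdiff_eq_left, Set.disjoint_left]
      intro e he hd
      have := hAX he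
      simp only [SimpleGraph.mem_edgeFinset, SimpleGraph.edgeSet_top] at this
      exact this hd
    refine ⟨SimpleGraph.fromEdgeSet A, ?_, ?_⟩
    · simp [hset, Set.ncard_coe_finset, hc]
    · rw [← Finset.coe_inj, SimpleGraph.coe_edgeFinset, hset]

open Classical in
/-- The probability of `Q` in the random graph is bounded below by covering the edge sets of the
graphs without the property `Q`. -/
theorem one_sub_le_randomGraph_real {n m : ℕ} (hm : m ≤ n.choose 2)
    (Q : SimpleGraph (Fin n) → Prop) (B : Finset (Finset (Sym2 (Fin n)))) (ε : ℝ)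
    (hB : ∀ (G : SimpleGraph (Fin n)) [Fintype G.edgeSet], G.edgeFinset.card = m → ¬ Q G →
      G.edgeFinset ∈ B)
    (hε : (B.card : ℝ) ≤ (n.choose 2).choose m * ε) :
    1 - ε ≤ (randomGraph n m).real {G | Q G} := by
  set Ω := (Finset.univ : Finset (SimpleGraph (Fin n))).filter fun G => G.edgeSet.ncard = m
    with hΩ
  have hcard : Ω.card = (n.choose 2).choose m := by
    have h := card_filter_ncard_edgeSet_eq (V := Fin n) m
    rw [Fintype.card_fin] at h
    rw [← h, hΩ]
    congr!
  have hpos : (0 : ℝ) < (n.choose 2).choose m := by exact_mod_cast Nat.choose_pos hm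
  have hreal : (randomGraph n m).real {G | Q G} =
      ((Ω.filter Q).card : ℝ) / (n.choose 2).choose m := by
    have h1 : {G : SimpleGraph (Fin n) | G.edgeSet.ncard = m} = (Ω : Set _) := by
      ext; simp [hΩ]
    have h2 : {G : SimpleGraph (Fin n) | Q G} = ((Finset.univ.filter Q : Finset _) : Set _) := by
      ext; simp
    rw [randomGraph, MeasureTheory.measureReal_def, h1, h2,
      ProbabilityTheory.uniformOn_apply_finset, hcard]
    simp [ENNReal.toReal_div, Finset.inter_filter]
  have hbad : (Ω.filter fun G => ¬ Q G).card ≤ B.card := by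
    refine Finset.card_le_card_of_injOn (fun G => G.edgeFinset) ?_ ?_
    · intro G hG
      simp only [hΩ, Finset.coe_filter, Finset.mem_filter, Finset.mem_univ, true_and,
        Set.mem_ofPred_eq] at hG
      rw [← SimpleGraph.coe_edgeFinset, Set.ncard_coe_finset] at hG
      exact hB G hG.1 hG.2
    · intro G _ H _ h
      exact SimpleGraph.edgeFinset_inj.1 h
  have hsplit := Finset.card_filter_add_card_filter_not (s := Ω) Q
  rw [hreal, le_div_iff₀ hpos]
  have h3 : ((Ω.filter Q).card : ℝ) + (Ω.filter fun G => ¬ Q G).card = (n.choose 2).choose m := by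
    rw [← hcard]
    exact_mod_cast hsplit
  have h4 : ((Ω.filter fun G => ¬ Q G).card : ℝ) ≤ B.card := by exact_mod_cast hbad
  linarith

theorem autFraction_eq_card_div {V : Type*} [DecidableEq V] (G : SimpleGraph V)
    [Fintype G.edgeSet] (π : Equiv.Perm V) :
    autFraction G π =
      ((G.edgeFinset.filter fun e => pairPerm π e ∈ G.edgeFinset).card : ℝ) /
        G.edgeFinset.card := by
  have h : {e : Sym2 V | e ∈ G.edgeSet ∧ Sym2.map π e ∈ G.edgeSet} =
      ((G.edgeFinset.filter fun e => pairPerm π e ∈ G.edgeFinset : Finset _) : Set _) := by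
    ext e
    rw [Finset.mem_coe, Finset.mem_filter, SimpleGraph.mem_edgeFinset, SimpleGraph.mem_edgeFinset]
    rfl
  rw [autFraction, isoFraction, max_self, h, Set.ncard_coe_finset,
    ← SimpleGraph.coe_edgeFinset, Set.ncard_coe_finset]

/-! ### Numerical estimates -/

theorem choose_le_exp_add_of_le_mul_exp {n k : ℕ} {t : ℝ} (h : (n : ℝ) ≤ k * Real.exp t) :
    (n.choose k : ℝ) ≤ Real.exp (k + k * t) := by
  have hk := Real.pow_div_factorial_le_exp (k : ℝ) (Nat.cast_nonneg k) k
  calc (n.choose k : ℝ) ≤ (n : ℝ) ^ k / k.factorial := Nat.choose_le_pow_div k n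
    _ ≤ (k * Real.exp t) ^ k / k.factorial := by gcongr
    _ = (k : ℝ) ^ k / k.factorial * Real.exp (k * t) := by
      rw [mul_pow, ← Real.exp_nat_mul]; ring
    _ ≤ Real.exp k * Real.exp (k * t) := by gcongr
    _ = _ := by rw [Real.exp_add]

theorem choose_le_exp_mul_div_pow (N : ℕ) {j : ℕ} (hj : 0 < j) :
    (N.choose j : ℝ) ≤ (Real.exp 1 * N / j) ^ j := by
  have hk := Real.pow_div_factorial_le_exp (j : ℝ) (Nat.cast_nonneg j) j
  have hj' : (0 : ℝ) < j := by exact_mod_cast hj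
  calc (N.choose j : ℝ) ≤ (N : ℝ) ^ j / j.factorial := Nat.choose_le_pow_div j N
    _ = (N / j : ℝ) ^ j * ((j : ℝ) ^ j / j.factorial) := by
      rw [div_pow]; field_simp
    _ ≤ (N / j : ℝ) ^ j * Real.exp j := by gcongr
    _ = _ := by
      rw [← mul_one (j : ℝ), Real.exp_nat_mul, ← mul_pow, mul_one]
      ring

/-- If `k ≥ n e^{-c/6}` and `k ≥ 2`, then `c k ≥ 11 log n`. The extreme case is
`k = 2`, where `c ≥ 6 log (n / 2)`. -/
theorem eleven_mul_log_le {n k : ℕ} {c s : ℝ} (hs : s ^ 2 = n) (hs7 : (10 : ℝ) ^ 7 ≤ s)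
    (hlog : 2000 * Real.log n ≤ s) (hc : (10 : ℝ) ^ 4 ≤ c) (hk : 2 ≤ k)
    (hkc : (n : ℝ) ≤ k * Real.exp (c / 6)) :
    11 * Real.log n ≤ c * k := by
  have hn0 : (0 : ℝ) < n := by rw [← hs]; positivity
  have hk0 : (0 : ℝ) < k := by exact_mod_cast (by omega : 0 < k)
  have hc6 : Real.log n ≤ Real.log k + c / 6 := by
    have := Real.log_le_log hn0 hkc
    rwa [Real.log_mul hk0.ne' (Real.exp_pos _).ne', Real.log_exp] at this
  have hlogn : 28 ≤ Real.log n := by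
    rw [Real.le_log_iff_exp_le hn0, ← hs]
    have he : Real.exp 28 ≤ 2.7182818286 ^ 28 := by
      rw [show (28 : ℝ) = (28 : ℕ) * 1 by norm_num, Real.exp_nat_mul]
      gcongr
      exact Real.exp_one_lt_d9.le
    calc _ ≤ _ := he
      _ ≤ ((10 : ℝ) ^ 7) ^ 2 := by norm_num
      _ ≤ s ^ 2 := by gcongr
  rcases (show k = 2 ∨ k = 3 ∨ 4 ≤ k by omega) with rfl | rfl | hk4
  · have h2 := Real.log_two_lt_d9
    push_cast at hc6 ⊢
    nlinarith
  · have h3 : Real.log 3 ≤ 2 := by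
      have := Real.log_le_sub_one_of_pos (show (0 : ℝ) < 3 by norm_num)
      linarith
    push_cast at hc6 ⊢
    nlinarith
  · have hk4' : (4 : ℝ) ≤ k := by exact_mod_cast hk4
    rcases le_total (k : ℝ) s with hks | hks
    · have hlk : Real.log k ≤ Real.log n / 2 := by
        rw [← hs, Real.log_pow]
        have := Real.log_le_log hk0 hks
        push_cast
        linarith
      nlinarith
    · nlinarith

/-- The number of supports of size `k` times the probability that few edges meet a given one. -/
theorem choose_mul_exp_sub_le {n k τ : ℕ} {m c s : ℝ} (hs : s ^ 2 = n) (hs7 : (10 : ℝ) ^ 7 ≤ s)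
    (hlog : 2000 * Real.log n ≤ s) (hc : (10 : ℝ) ^ 4 ≤ c) (hm : m = c * n) (hk : 2 ≤ k)
    (hkn : k ≤ n) (hkc : (n : ℝ) ≤ k * Real.exp (c / 6))
    (hτ : n.choose 2 ≤ τ + (n - k).choose 2) :
    (n.choose k : ℝ) * Real.exp (4 * (c * k / 24) - (1 - Real.exp (-4)) *
      (τ * m / n.choose 2)) ≤ Real.exp (-(17 * Real.log n)) := by
  have hn0 : (10 : ℝ) ^ 14 ≤ n := by
    rw [← hs]
    calc (10 : ℝ) ^ 14 = (10 ^ 7) ^ 2 := by norm_num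
      _ ≤ _ := by gcongr
  have hk2 : (2 : ℝ) ≤ k := by exact_mod_cast hk
  have hkn' : (k : ℝ) ≤ n := by exact_mod_cast hkn
  have hn1 : (0 : ℝ) < n - 1 := by linarith
  -- The mean number of edges meeting a set of `k` vertices.
  have hmean : c * k * (1 + (n - k) / (n - 1)) ≤ τ * m / n.choose 2 := by
    have hτ' : (n.choose 2 : ℝ) ≤ τ + (n - k).choose 2 := by exact_mod_cast hτ
    rw [Nat.cast_choose_two, Nat.cast_choose_two, Nat.cast_sub hkn] at hτ'
    rw [Nat.cast_choose_two, hm, le_div_iff₀ (by positivity)]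
    have hrw : c * k * (1 + ((n : ℝ) - k) / (n - 1)) * (n * (n - 1) / 2) =
        c * n * ((n * (n - 1) - (n - k) * (n - k - 1)) / 2) := by
      field_simp; ring
    rw [hrw, mul_comm (τ : ℝ)]
    gcongr
    linarith
  have he4 : Real.exp (-4) ≤ 0.02 := by
    rw [Real.exp_neg, inv_le_comm₀ (Real.exp_pos _) (by norm_num)]
    calc (0.02 : ℝ)⁻¹ ≤ 2.7 ^ 4 := by norm_num
      _ ≤ (Real.exp 1) ^ 4 := by
        gcongr
        have := Real.exp_one_gt_d9
        linarith
      _ = Real.exp 4 := by rw [← Real.exp_nat_mul]; norm_num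
  have hck : (10 : ℝ) ^ 4 * k ≤ c * k := by gcongr
  have hratio : 0 ≤ ((n : ℝ) - k) / (n - 1) := div_nonneg (by linarith) hn1.le
  have hlow : 0.98 * (c * k * (1 + (n - k) / (n - 1))) ≤
      (1 - Real.exp (-4)) * (τ * m / n.choose 2) := by
    have h0 : 0 ≤ c * k * (1 + ((n : ℝ) - k) / (n - 1)) := by positivity
    nlinarith
  refine (mul_le_mul_of_nonneg_right (choose_le_exp_add_of_le_mul_exp hkc)
    (Real.exp_pos _).le).trans ?_
  rw [← Real.exp_add, Real.exp_le_exp]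
  have hckpos : 0 ≤ c * k := by positivity
  -- The mean is nearly `2 c k` for small `k`, where `c k` may be only of order `log n`; for larger
  -- `k` a mean of `c k` is enough, as then `c k ≥ 100 n`.
  rcases le_total (100 * (k : ℝ)) n with hsmall | hlarge
  · have hr : 0.99 ≤ ((n : ℝ) - k) / (n - 1) := by
      rw [le_div_iff₀ hn1]; linarith
    have h11 := eleven_mul_log_le hs hs7 hlog hc hk hkc
    nlinarith
  · have hln := Real.log_le_sub_one_of_pos (show (0 : ℝ) < n by linarith)
    nlinarith

/-- The number of permutations with support of size `k` times the probability that a given one maps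
`j` of the edges to `j` further edges. -/
theorem pow_mul_choose_mul_div_pow_le {n k j : ℕ} {m c s : ℝ} (hs : s ^ 2 = n)
    (hs7 : (10 : ℝ) ^ 7 ≤ s) (hlog : 2000 * Real.log n ≤ s) (hc : (10 : ℝ) ^ 4 ≤ c)
    (hcn : c ≤ n / (10 : ℝ) ^ 10) (hm : m = c * n) (hk : 2 ≤ k) (hj : c * k / 100 ≤ j) :
    (n : ℝ) ^ k * ((n : ℝ) ^ k * (((k * n).choose j : ℕ) * (m / n.choose 2) ^ (2 * j))) ≤
      Real.exp (-(17 * Real.log n)) := by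
  have hn0 : (10 : ℝ) ^ 14 ≤ n := by
    rw [← hs]
    calc (10 : ℝ) ^ 14 = (10 ^ 7) ^ 2 := by norm_num
      _ ≤ _ := by gcongr
  have hnpos : (0 : ℝ) < n := by linarith
  have hspos : (0 : ℝ) < s := by linarith
  have hcpos : (0 : ℝ) < c := by linarith
  have hk2 : (2 : ℝ) ≤ k := by exact_mod_cast hk
  have hn1 : (0 : ℝ) < n - 1 := by linarith
  have hjpos : (0 : ℝ) < j := lt_of_lt_of_le (by positivity) hj
  have hlogn : 0 ≤ Real.log n := Real.log_nonneg (by linarith)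
  -- The constant `1100` is a rounding of `400 e`, which arises as `100 e * 2 ^ 2`.
  set L := Real.log (n / (1100 * c)) with hL
  have hbase : Real.exp 1 * ((k * n : ℕ) : ℝ) / j * (m / n.choose 2) ^ 2 ≤ Real.exp (-L) := by
    have h1 : Real.exp 1 * ((k * n : ℕ) : ℝ) / j ≤ 271.9 * n / c := by
      rw [div_le_div_iff₀ hjpos hcpos]
      have he := Real.exp_one_lt_d9
      push_cast
      calc Real.exp 1 * (k * n) * c ≤ 2.719 * (k * n) * c := by gcongr; linarith
        _ = 271.9 * n * (c * k / 100) := by ring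
        _ ≤ _ := by gcongr
    have h2 : m / n.choose 2 ≤ 2.01 * c / n := by
      rw [Nat.cast_choose_two, hm, div_le_div_iff₀ (by positivity) hnpos]
      have : c * n * (n : ℝ) ≤ c * n * (2.01 / 2 * (n - 1)) := by
        gcongr
        linarith
      linarith
    have h3 : 0 ≤ m / n.choose 2 := by rw [hm]; positivity
    have h4 : Real.exp (-L) = 1100 * c / n := by
      rw [hL, Real.exp_neg, Real.exp_log (by positivity), inv_div]
    rw [h4]
    calc _ ≤ 271.9 * n / c * (2.01 * c / n) ^ 2 := by gcongr
      _ = (271.9 * 2.01 ^ 2) * c / n := by field_simp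
      _ ≤ _ := by gcongr; norm_num
  -- Up to `c = √n` the logarithm `L` is of order `log n`; beyond that, the factor `c` dominates.
  have hLkey : 0 ≤ L ∧ 11 * Real.log n ≤ c / 100 * L := by
    rcases le_total c s with hcs | hcs
    · have hL' : Real.log n / 4 ≤ L := by
        rw [hL, ← hs, Real.log_pow, show ((2 : ℕ) : ℝ) * Real.log s / 4 = Real.log s / 2 by
          push_cast; ring, ← Real.log_sqrt hspos.le]
        refine Real.log_le_log (by positivity) ?_
        rw [le_div_iff₀ (by positivity)]
        have hsq : 1100 ≤ Real.sqrt s := Real.le_sqrt_of_sq_le (by linarith)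
        have hss := Real.mul_self_sqrt hspos.le
        calc √s * (1100 * c) ≤ √s * (√s * s) := by gcongr
          _ = s ^ 2 := by rw [← mul_assoc, hss]; ring
      refine ⟨by linarith, ?_⟩
      nlinarith
    · have hL' : 1 ≤ L := by
        rw [hL, Real.le_log_iff_exp_le (by positivity), le_div_iff₀ (by positivity)]
        have he := Real.exp_one_lt_d9
        have : c * (10 : ℝ) ^ 10 ≤ n := by rwa [le_div_iff₀ (by positivity)] at hcn
        nlinarith
      refine ⟨by linarith, ?_⟩
      nlinarith
  have hpow : (n : ℝ) ^ k = Real.exp (k * Real.log n) := by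
    rw [Real.exp_nat_mul, Real.exp_log hnpos]
  calc _ ≤ (n : ℝ) ^ k * ((n : ℝ) ^ k * ((Real.exp 1 * ((k * n : ℕ) : ℝ) / j) ^ j *
        (m / n.choose 2) ^ (2 * j))) := by
        have : 0 ≤ (m / n.choose 2) ^ (2 * j) := by rw [pow_mul]; positivity
        gcongr
        exact choose_le_exp_mul_div_pow _ (by exact_mod_cast hjpos)
    _ = (n : ℝ) ^ k * ((n : ℝ) ^ k * (Real.exp 1 * ((k * n : ℕ) : ℝ) / j *
        (m / n.choose 2) ^ 2) ^ j) := by rw [mul_pow _ _ j, pow_mul]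
    _ ≤ (n : ℝ) ^ k * ((n : ℝ) ^ k * (Real.exp (-L)) ^ j) := by gcongr
    _ = Real.exp (2 * k * Real.log n - j * L) := by
      rw [hpow, ← Real.exp_nat_mul, ← Real.exp_add, ← Real.exp_add]
      ring_nf
    _ ≤ _ := by
      rw [Real.exp_le_exp]
      have h1 : c * k / 100 * L ≤ j * L := mul_le_mul_of_nonneg_right hj hLkey.1
      have h2 : k * (11 * Real.log n) ≤ k * (c / 100 * L) :=
        mul_le_mul_of_nonneg_left hLkey.2 (Nat.cast_nonneg k)
      nlinarith

/-- The requirements on the size of `n`, with `s` in the role of `√n`. -/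
theorem exists_sqrt_log_bound : ∃ N : ℕ, ∀ n : ℕ, N ≤ n →
    ∃ s : ℝ, s ^ 2 = n ∧ (10 : ℝ) ^ 7 ≤ s ∧ 2000 * Real.log n ≤ s := by
  have h1 := (isLittleO_log_rpow_atTop (show (0 : ℝ) < 1 / 2 by norm_num)).bound
    (show (0 : ℝ) < 1 / 2000 by norm_num)
  have h2 := (h1.and (Filter.eventually_ge_atTop ((10 : ℝ) ^ 14))).natCast_atTop
  obtain ⟨N, hN⟩ := Filter.eventually_atTop.1 h2
  refine ⟨N, fun n hn => ⟨Real.sqrt n, Real.sq_sqrt (Nat.cast_nonneg n), ?_, ?_⟩⟩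
  · refine Real.le_sqrt_of_sq_le ?_
    have := (hN n hn).2
    norm_num at this ⊢
    exact this
  · have h := (hN n hn).1
    rw [← Real.sqrt_eq_rpow, Real.norm_of_nonneg (Real.sqrt_nonneg _)] at h
    have := (le_abs_self _).trans h
    linarith

/-! ### The union bound -/

/-- All edge sets that are bad for some set of vertices large enough to be the support of one of the
permutations under consideration. -/
noncomputable def allBadEdgeSets (n m : ℕ) (c : ℝ) : Finset (Finset (Sym2 (Fin n))) :=
  ((Finset.univ : Finset (Fin n)).powerset.filter fun S =>
    2 ≤ S.card ∧ (n : ℝ) ≤ S.card * Real.exp (c / 6)).biUnion fun S =>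
      badEdgeSets m ⌈c * S.card / 100⌉₊ (c * S.card / 24) S

theorem card_allBadEdgeSets_le {n m : ℕ} {c s : ℝ} (hs : s ^ 2 = n) (hs7 : (10 : ℝ) ^ 7 ≤ s)
    (hlog : 2000 * Real.log n ≤ s) (hc : (10 : ℝ) ^ 4 ≤ c) (hcn : c ≤ n / (10 : ℝ) ^ 10)
    (hm : (m : ℝ) = c * n) :
    ((allBadEdgeSets n m c).card : ℝ) ≤ (n.choose 2).choose m * (1 / (n : ℝ) ^ 15) := by
  have hn0 : (10 : ℝ) ^ 14 ≤ n := by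
    rw [← hs]
    calc (10 : ℝ) ^ 14 = (10 ^ 7) ^ 2 := by norm_num
      _ ≤ _ := by gcongr
  have hnpos : (0 : ℝ) < n := by linarith
  set C : ℝ := (((n.choose 2).choose m : ℕ) : ℝ) with hC
  have hC0 : 0 ≤ C := Nat.cast_nonneg _
  set δ : ℝ := Real.exp (-(17 * Real.log n)) with hδ
  have hδ' : δ = 1 / (n : ℝ) ^ 17 := by
    rw [hδ, Real.exp_neg, show (17 : ℝ) * Real.log n = (17 : ℕ) * Real.log n by norm_num,
      Real.exp_nat_mul, Real.exp_log hnpos, one_div]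
  -- Each set of `k` vertices contributes at most a share `1 / n.choose k` of `2 δ C`.
  have hS : ∀ S ∈ (Finset.univ : Finset (Fin n)).powerset.filter (fun S =>
      2 ≤ S.card ∧ (n : ℝ) ≤ S.card * Real.exp (c / 6)),
      ((badEdgeSets m ⌈c * S.card / 100⌉₊ (c * S.card / 24) S).card : ℝ) ≤
        2 * δ * C / n.choose S.card := by
    intro S hS
    obtain ⟨-, hk, hkc⟩ := Finset.mem_filter.1 hS
    have hkn : S.card ≤ n := by simpa using S.card_le_univ
    have hpos : (0 : ℝ) < n.choose S.card := by exact_mod_cast Nat.choose_pos hkn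
    have hτ := choose_two_le_card_pairsMeeting_add S
    have h := card_badEdgeSets_le m ⌈c * S.card / 100⌉₊ (c * S.card / 24) S
    rw [Fintype.card_fin] at hτ h
    have h1 := choose_mul_exp_sub_le hs hs7 hlog hc hm hk hkn hkc hτ
    have h2 := pow_mul_choose_mul_div_pow_le hs hs7 hlog hc hcn hm hk
      (Nat.le_ceil (c * S.card / 100))
    have hck : (n.choose S.card : ℝ) ≤ (n : ℝ) ^ S.card := by
      exact_mod_cast Nat.choose_le_pow n S.card
    rw [le_div_iff₀ hpos]
    refine (mul_le_mul_of_nonneg_right h hpos.le).trans ?_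
    rw [mul_assoc, add_mul, mul_comm (2 * δ), two_mul δ]
    refine mul_le_mul_of_nonneg_left (add_le_add ?_ ?_) hC0
    · rw [mul_comm]; exact h1
    · refine le_trans ?_ h2
      rw [mul_comm]
      gcongr
  have hsum : ((allBadEdgeSets n m c).card : ℝ) ≤
      ∑ S ∈ (Finset.univ : Finset (Fin n)).powerset, 2 * δ * C / n.choose S.card := by
    refine le_trans (Nat.cast_le.2 Finset.card_biUnion_le) ?_
    push_cast
    refine (Finset.sum_le_sum hS).trans ?_
    refine Finset.sum_le_sum_of_subset_of_nonneg (Finset.filter_subset _ _) fun S _ _ => ?_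
    positivity
  refine hsum.trans ?_
  rw [Finset.sum_powerset_apply_card (fun k => 2 * δ * C / n.choose k), Finset.card_univ,
    Fintype.card_fin]
  have hterm : ∀ k ∈ Finset.range (n + 1), n.choose k • (2 * δ * C / n.choose k) = 2 * δ * C := by
    intro k hk
    have hpos : (0 : ℝ) < n.choose k := by
      exact_mod_cast Nat.choose_pos (Nat.lt_succ_iff.1 (Finset.mem_range.1 hk))
    rw [nsmul_eq_mul, mul_div_cancel₀ _ hpos.ne']
  rw [Finset.sum_congr rfl hterm, Finset.sum_const, Finset.card_range, nsmul_eq_mul, hδ']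
  have hfin : ((n + 1 : ℕ) : ℝ) * (2 * (1 / (n : ℝ) ^ 17)) ≤ 1 / (n : ℝ) ^ 15 := by
    rw [show (n : ℝ) ^ 17 = (n : ℝ) ^ 15 * (n * n) by ring]
    rw [mul_one_div, mul_div_assoc', div_le_div_iff₀ (by positivity) (by positivity), one_mul,
      mul_comm]
    refine mul_le_mul_of_nonneg_left ?_ (by positivity)
    push_cast
    nlinarith
  calc _ = C * (((n + 1 : ℕ) : ℝ) * (2 * (1 / (n : ℝ) ^ 17))) := by ring
    _ ≤ _ := by gcongr

/-- A graph for which some permutation violates asymmetry has its edge set among the bad ones. Only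
the number `k` of moved vertices matters, as `β ≤ k / n`. -/
theorem edgeFinset_mem_allBadEdgeSets {n m : ℕ} {c β : ℝ} (hn : 0 < n) (hc : (10 : ℝ) ^ 4 ≤ c)
    (hm : (m : ℝ) = c * n) {G : SimpleGraph (Fin n)} [Fintype G.edgeSet]
    (hG : G.edgeFinset.card = m)
    (hβ : max (Real.exp (-c / 6)) (1 / (n : ℝ)) ≤ β) (h : ¬ IsRobustlyAsymmetric G β (β / 240)) :
    G.edgeFinset ∈ allBadEdgeSets n m c := by
  have hn0 : (0 : ℝ) < n := by exact_mod_cast hn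
  have hc0 : (0 : ℝ) < c := by linarith
  simp only [IsRobustlyAsymmetric, not_forall, not_lt] at h
  obtain ⟨π, hfix, haut⟩ := h
  have hfixed : {v : Fin n | π v = v}.ncard + π.support.card = n := by
    have h1 : {v : Fin n | π v = v} = ((π.supportᶜ : Finset _) : Set (Fin n)) := by
      ext; simp
    rw [h1, Set.ncard_coe_finset, Finset.card_compl_add_card, Fintype.card_fin]
  have hk : β * n ≤ π.support.card := by
    have h2 : (({v : Fin n | π v = v}.ncard : ℕ) : ℝ) + π.support.card = n := by
      exact_mod_cast hfixed
    rw [Nat.card_eq_fintype_card, Fintype.card_fin] at hfix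
    linarith
  have hk1 : (1 : ℝ) ≤ π.support.card := by
    refine le_trans ?_ hk
    rw [← div_le_iff₀ hn0]
    exact (le_max_right _ _).trans hβ
  -- No permutation moves exactly one point.
  have hk2 : 2 ≤ π.support.card := by
    have h1 : 1 ≤ π.support.card := by exact_mod_cast hk1
    have := Equiv.Perm.card_support_ne_one π
    omega
  have hkc : (n : ℝ) ≤ π.support.card * Real.exp (c / 6) := by
    have h1 : Real.exp (-c / 6) * n ≤ π.support.card :=
      (mul_le_mul_of_nonneg_right ((le_max_left _ _).trans hβ) hn0.le).trans hk
    rw [neg_div, Real.exp_neg, inv_mul_le_iff₀ (Real.exp_pos _)] at h1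
    linarith
  have hm0 : (0 : ℝ) < m := by rw [hm]; positivity
  have hpres : (m : ℝ) - c * π.support.card / 240 ≤
      (G.edgeFinset.filter fun e => pairPerm π e ∈ G.edgeFinset).card := by
    rw [autFraction_eq_card_div, hG, le_div_iff₀ hm0] at haut
    refine le_trans ?_ haut
    have : c * (β * n) ≤ c * π.support.card := by gcongr
    rw [hm]
    linarith
  refine Finset.mem_biUnion.2 ⟨π.support, Finset.mem_filter.2 ⟨by simp, hk2, hkc⟩, ?_⟩
  have hX : G.edgeFinset ∈ (⊤ : SimpleGraph (Fin n)).edgeFinset.powersetCard m :=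
    Finset.mem_powersetCard.2 ⟨SimpleGraph.edgeFinset_mono le_top, hG⟩
  rw [badEdgeSets, Finset.mem_union]
  rcases le_or_gt (((G.edgeFinset ∩ pairsMeeting π.support).card : ℕ) : ℝ)
    (c * π.support.card / 24) with hle | hgt
  · exact Or.inl (Finset.mem_filter.2 ⟨hX, hle⟩)
  · refine Or.inr (Finset.mem_biUnion.2 ⟨π, by simp, Finset.mem_filter.2 ⟨hX, ?_⟩⟩)
    refine exists_subset_pairsMeeting_disjoint_map π _ _ ?_
    have hk2' : (2 : ℝ) ≤ π.support.card := by exact_mod_cast hk2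
    have hj := Nat.ceil_lt_add_one (show 0 ≤ c * (π.support.card : ℝ) / 100 by positivity)
    have hck : (10 : ℝ) ^ 4 * π.support.card ≤ c * π.support.card := by gcongr
    rw [← Nat.cast_le (α := ℝ), hG]
    push_cast
    linarith

theorem theorem3 :
    ∃ N : ℕ, ∀ n : ℕ, N ≤ n → ∀ (m : ℕ) (c : ℝ), (m : ℝ) = c * (n : ℝ) →
      (10 : ℝ) ^ 4 ≤ c → c ≤ (n : ℝ) / (10 : ℝ) ^ 10 →
        1 - 1 / (n : ℝ) ^ 15 ≤
          (randomGraph n m).real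
            {G : SimpleGraph (Fin n) | ∀ β : ℝ,
              max (Real.exp (-c / 6)) (1 / (n : ℝ)) ≤ β → β ≤ 1 →
                IsRobustlyAsymmetric G β (β / 240)} := by
  obtain ⟨N, hN⟩ := exists_sqrt_log_bound
  refine ⟨N, fun n hn m c hm hc hcn => ?_⟩
  obtain ⟨s, hs, hs7, hlog⟩ := hN n hn
  have hn0 : (10 : ℝ) ^ 14 ≤ n := by
    rw [← hs]
    calc (10 : ℝ) ^ 14 = (10 ^ 7) ^ 2 := by norm_num
      _ ≤ _ := by gcongr
  have hmn : m ≤ n.choose 2 := by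
    rw [← Nat.cast_le (α := ℝ), Nat.cast_choose_two, hm, mul_comm, mul_div_assoc]
    refine mul_le_mul_of_nonneg_left ?_ (Nat.cast_nonneg n)
    refine hcn.trans ?_
    rw [div_le_div_iff₀ (by positivity) (by positivity)]
    linarith
  refine one_sub_le_randomGraph_real hmn _ (allBadEdgeSets n m c) _ ?_
    (card_allBadEdgeSets_le hs hs7 hlog hc hcn hm)
  intro G _ hG hQ
  push Not at hQ
  obtain ⟨β, hβ, -, h⟩ := hQ
  refine edgeFinset_mem_allBadEdgeSets ?_ hc hm hG hβ h
  exact_mod_cast (show (0 : ℝ) < n by linarith)
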